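/- Let $M$ be a smooth ($C^\infty$, finite-dimensional, boundaryless) manifold. A Dirac structure on $M$ is a smooth vector subbundle $D\subseteq TM\oplus T^*M$ that is maximal isotropic for $g((X,\alpha),(Y,\beta))=\tfrac12(\alpha(Y)+\beta(X))$ and whose (local) smooth sections are closed under the Courant bracket $$[(X,\alpha),(Y,\beta)]=\bigl([X,Y],\,L_X\beta-L_Y\alpha+\tfrac12 d(\alpha(Y)-\beta(X))\bigr).$$ Let $x^i$ be local coordinates on $M$ and $(x^i,v^i)$ the induced coordinates on $TM$, with projection $\pi:TM\to M$. For a vector field $X=\xi^i\,\partial/\partial x^i$ and a 1-form $\alpha=\alpha_i\,dx^i$ the vertical and complete lifts to $TM$ are $$X^V=\xi^i\frac{\partial}{\partial v^i},\quad X^C=\xi^i\frac{\partial}{\partial x^i}+v^i\frac{\partial \xi^j}{\partial x^i}\frac{\partial}{\partial v^j},\quad \alpha^V=\pi^*\alpha,\quad \alpha^C=v^j\frac{\partial\alpha_i}{\partial x^j}dx^i+\alpha_i\,dv^i .$$ For a Dirac structure $D$ on $M$, the tangent Dirac structure $D^{tg}\subseteq T(TM)\oplus T^*(TM)$ is the subbundle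 whose fibre at $v\in TM$ is spanned by the values at $v$ of the pairs $(X^C,\alpha^C)$ and $(X^V,\alpha^V)$, where $(X,\alpha)$ runs over the smooth local sections of $D$ near $\pi(v)$. Let $E=v^i\,\partial/\partial v^i$ be the Euler vector field of $TM$. **Proposition.** For an arbitrary Dirac structure $D$ on $M$, the tangent Dirac structure $D^{tg}$ is homogeneous with respect to $E$: for every smooth section $(\mathcal X,\Xi)$ of $D^{tg}$ over an open subset of $TM$, the pair $$([E,\mathcal X]+\mathcal X,\;L_E\,\Xi)$$ takes its values in $D^{tg}$ on that open subset. -/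

import Mathlib

open Set Bundle VectorField
open scoped Manifold ContDiff Topology

noncomputable section

section DiracDefs

variable {E : Type*} [NormedAddCommGroup E] [NormedSpace ℝ E]
  {H : Type*} [TopologicalSpace H] (I : ModelWithCorners ℝ E H)
  {M : Type*} [TopologicalSpace M] [ChartedSpace H M]

/-- The cotangent space `T*_x M`. -/
abbrev CotangentSpace (x : M) : Type _ := TangentSpace I x →L[ℝ] ℝ

/-- The fibre at `x` of the big tangent bundle `TM ⊕ T*M`. -/
abbrev BigTangent (x : M) : Type _ := TangentSpace I x × CotangentSpace I x

/-- The neutral metric `g((X, α), (Y, β)) = (α(Y) + β(X)) / 2` on `T_x M ⊕ T*_x M`. -/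
def neutralMetric {x : M} (a b : BigTangent I x) : ℝ :=
  (1 / 2) * (a.2 b.1 + b.2 a.1)

/-- The 2-form `ω((X, α), (Y, β)) = (α(Y) - β(X)) / 2` on `T_x M ⊕ T*_x M`. -/
def neutralForm {x : M} (a b : BigTangent I x) : ℝ :=
  (1 / 2) * (a.2 b.1 - b.2 a.1)

/-- A subspace of `T_x M ⊕ T*_x M` on which the neutral metric vanishes. -/
def IsIsotropic {x : M} (L : Submodule ℝ (BigTangent I x)) : Prop :=
  ∀ a ∈ L, ∀ b ∈ L, neutralMetric I a b = 0

/-- A maximal element among the isotropic subspaces of `T_x M ⊕ T*_x M`. -/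
def IsMaximalIsotropic {x : M} (L : Submodule ℝ (BigTangent I x)) : Prop :=
  IsIsotropic I L ∧ ∀ L' : Submodule ℝ (BigTangent I x), IsIsotropic I L' → L ≤ L' → L' = L

section OneForms

/-- The coefficients of the vector field `X` in the preferred chart at `x₀`, as a function on the
model space. -/
def vectorFieldInChart (X : Π x : M, TangentSpace I x) (x₀ : M) : E → E :=
  fun z => mpullbackWithin 𝓘(ℝ, E) I (extChartAt I x₀).symm X (range I) z

/-- The coefficients of the 1-form `α` in the preferred chart at `x₀`, as a function on the
model space: the pullback of `α` by the inverse of the chart. -/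
def oneFormInChart (α : Π x : M, CotangentSpace I x) (x₀ : M) : E → (E →L[ℝ] ℝ) :=
  fun z => (α ((extChartAt I x₀).symm z)).comp
    (mfderivWithin 𝓘(ℝ, E) I (extChartAt I x₀).symm (range I) z)

/-- The Lie derivative `L_Z α` of a 1-form, through its expression
`(L_Z α)_i = Z^j ∂_j α_i + α_j ∂_i Z^j` in the preferred chart at each point. -/
def lieDerivOneForm (Z : Π x : M, TangentSpace I x) (α : Π x : M, CotangentSpace I x)
    (x₀ : M) : CotangentSpace I x₀ :=
  let z₀ : E := extChartAt I x₀ x₀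
  let Z' := vectorFieldInChart I Z x₀
  let α' := oneFormInChart I α x₀
  (fderivWithin ℝ α' (range I) z₀ (Z' z₀) + (α' z₀).comp (fderivWithin ℝ Z' (range I) z₀)).comp
    (mfderiv I 𝓘(ℝ, E) (extChartAt I x₀) x₀)

/-- The differential of a real function, as a 1-form. -/
def diffOneForm (f : M → ℝ) (x : M) : CotangentSpace I x :=
  mfderiv I 𝓘(ℝ, ℝ) f x

/-- The Courant bracket
`[(X, α), (Y, β)] = ([X, Y], L_X β - L_Y α + d(ω((X, α), (Y, β))))`. -/
def courantBracket (s t : Π x : M, BigTangent I x) (x : M) : BigTangent I x :=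
  (mlieBracket I (fun y => (s y).1) (fun y => (t y).1) x,
    lieDerivOneForm I (fun y => (s y).1) (fun y => (t y).2) x
      - lieDerivOneForm I (fun y => (t y).1) (fun y => (s y).2) x
      + diffOneForm I (fun y => neutralForm I (s y) (t y)) x)

end OneForms

section Sections

variable [IsManifold I ∞ M]

/-- The pair `s = (X, α)` of a vector field and a 1-form is smooth on `U`. -/
def IsSmoothPairOn (s : Π x : M, BigTangent I x) (U : Set M) : Prop :=
  ContMDiffOn I (I.prod 𝓘(ℝ, E)) ∞
      (fun x => TotalSpace.mk' E (E := (TangentSpace I : M → Type _)) x (s x).1) U ∧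
  ContMDiffOn I (I.prod 𝓘(ℝ, E →L[ℝ] ℝ)) ∞
      (fun x => TotalSpace.mk' (E →L[ℝ] ℝ)
        (E := fun y : M => TangentSpace I y →L[ℝ] Bundle.Trivial M ℝ y) x (s x).2) U

/-- `s` is, over the open set `U`, a smooth section of the family of subspaces `D`.
The values of `s` outside `U` are irrelevant. -/
def IsSmoothSectionOn (D : Π x : M, Submodule ℝ (BigTangent I x))
    (s : Π x : M, BigTangent I x) (U : Set M) : Prop :=
  IsOpen U ∧ IsSmoothPairOn I s U ∧ ∀ x ∈ U, s x ∈ D x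

/-- The family of subspaces `D` is a smooth vector subbundle of `TM ⊕ T*M`: near each point it has
a frame of smooth sections. -/
def IsSmoothSubbundle (D : Π x : M, Submodule ℝ (BigTangent I x)) : Prop :=
  ∀ x₀ : M, ∃ U : Set M, IsOpen U ∧ x₀ ∈ U ∧ ∃ (r : ℕ) (s : Fin r → Π x : M, BigTangent I x),
    (∀ i, IsSmoothSectionOn I D (s i) U) ∧
    ∀ x ∈ U, LinearIndependent ℝ (fun i => s i x) ∧ Submodule.span ℝ (range fun i => s i x) = D x

/-- A Dirac structure on `M`: a maximal isotropic smooth subbundle of `TM ⊕ T*M` whose (local)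
smooth sections are closed under the Courant bracket. -/
structure IsDiracStructure (D : Π x : M, Submodule ℝ (BigTangent I x)) : Prop where
  isSmoothSubbundle : IsSmoothSubbundle I D
  isMaximalIsotropic : ∀ x, IsMaximalIsotropic I (D x)
  courant_closed : ∀ (U : Set M) (s t : Π x : M, BigTangent I x),
    IsSmoothSectionOn I D s U → IsSmoothSectionOn I D t U → ∀ x ∈ U, courantBracket I s t x ∈ D x

/-- `D` is homogeneous with respect to the vector field `Z`: for each smooth section `(X, α)` of
`D` over an open set, `([Z, X] + X, L_Z α)` takes its values in `D` there. -/
def IsHomogeneousDirac (D : Π x : M, Submodule ℝ (BigTangent I x))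
    (Z : Π x : M, TangentSpace I x) : Prop :=
  ∀ (U : Set M) (s : Π x : M, BigTangent I x), IsSmoothSectionOn I D s U →
    ∀ x ∈ U, ((mlieBracket I Z (fun y => (s y).1) x + (s x).1,
      lieDerivOneForm I Z (fun y => (s y).2) x) : BigTangent I x) ∈ D x

end Sections

section Lifts

variable [IsManifold I ∞ M]

/-- The vertical tangent vector at `v ∈ T_x M` given by `w ∈ T_x M`: the image of `w` under the
differential at `v` of the inclusion of the fibre `T_x M` in `TM`
(in coordinates, `w^i ∂/∂v^i`). -/
def verticalVector (v : TangentBundle I M) (w : TangentSpace I v.proj) :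
    TangentSpace I.tangent v :=
  mfderiv 𝓘(ℝ, E) I.tangent (fun u : E => (⟨v.proj, u⟩ : TangentBundle I M)) v.snd w

/-- The Euler vector field `v^i ∂/∂v^i` of `TM`. -/
def eulerField (v : TangentBundle I M) : TangentSpace I.tangent v :=
  verticalVector I v v.snd

/-- The vertical lift `X^V` of a vector field (in coordinates, `ξ^i ∂/∂v^i`). -/
def verticalLiftVector (X : Π x : M, TangentSpace I x) (v : TangentBundle I M) :
    TangentSpace I.tangent v :=
  verticalVector I v (X v.proj)

/-- The vertical lift `α^V = π^* α` of a 1-form. -/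
def verticalLiftForm (α : Π x : M, CotangentSpace I x) (v : TangentBundle I M) :
    CotangentSpace I.tangent v :=
  (α v.proj).comp (mfderiv I.tangent I (fun u : TangentBundle I M => u.proj) v)

/-- The complete lift `X^C` of a vector field `X = ξ^i ∂/∂x^i`, through its expression
`ξ^i ∂/∂x^i + v^i (∂ξ^j/∂x^i) ∂/∂v^j` in the preferred chart of `TM` at each point, which is the
chart `(x^i, v^i)` induced by the preferred chart of `M` at the base point. -/
def completeLiftVector (X : Π x : M, TangentSpace I x) (v : TangentBundle I M) :
    TangentSpace I.tangent v :=
  let p : E × E := extChartAt I.tangent v v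
  let ξ := vectorFieldInChart I X v.proj
  mfderivWithin 𝓘(ℝ, E × E) I.tangent (extChartAt I.tangent v).symm (range I.tangent) p
    ((ξ p.1, fderivWithin ℝ ξ (range I) p.1 p.2) : E × E)

/-- The complete lift `α^C` of a 1-form `α = α_i dx^i`, through its expression
`v^j (∂α_i/∂x^j) dx^i + α_i dv^i` in the preferred chart of `TM` at each point. -/
def completeLiftForm (α : Π x : M, CotangentSpace I x) (v : TangentBundle I M) :
    CotangentSpace I.tangent v :=
  let p : E × E := extChartAt I.tangent v v
  let a := oneFormInChart I α v.proj
  ((fderivWithin ℝ a (range I) p.1 p.2).coprod (a p.1)).comp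
    (mfderiv I.tangent 𝓘(ℝ, E × E) (extChartAt I.tangent v) v)

/-- The tangent Dirac structure `D^tg` on `TM`: its fibre at `v` is spanned by the values at `v` of
the pairs `(X^C, α^C)` and `(X^V, α^V)`, for all smooth sections `(X, α)` of `D` defined near the
base point of `v`. -/
def tangentDirac (D : Π x : M, Submodule ℝ (BigTangent I x))
    (v : TangentBundle I M) : Submodule ℝ (BigTangent I.tangent v) :=
  Submodule.span ℝ {a | ∃ (U : Set M) (s : Π x : M, BigTangent I x),
    IsSmoothSectionOn I D s U ∧ v.proj ∈ U ∧
    (a = (completeLiftVector I (fun x => (s x).1) v, completeLiftForm I (fun x => (s x).2) v) ∨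
     a = (verticalLiftVector I (fun x => (s x).1) v, verticalLiftForm I (fun x => (s x).2) v))}

end Lifts

end DiracDefs

end

/-! The flow of the Euler field is fibre scaling `(x, v) ↦ (x, t v)`. Pull back a pair along this
map and multiply its vector part by `t`: complete lifts at `t v` become `t` times complete lifts at
`v`, since `v` enters them linearly, and vertical lifts are unchanged. Hence this operation sends
the fibre of `D^tg` at `t v` into the fibre at `v` (`homogeneousPullback_mem_tangentDirac`). Applied
to a section, it gives a curve in one fixed finite-dimensional fibre. Its velocity at `t = 1` is
`([E, X] + X, L_E α)` (`hasDerivAt_homogeneousPullback`), and it stays in the fibre because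
subspaces are closed (`HasDerivAt.mem_submodule`). -/

noncomputable section

/-! ### Brackets and Lie derivatives in the preferred chart -/

section Charts

variable {E : Type*} [NormedAddCommGroup E] [NormedSpace ℝ E]
  {H : Type*} [TopologicalSpace H] (I : ModelWithCorners ℝ E H)
  {M : Type*} [TopologicalSpace M] [ChartedSpace H M] [IsManifold I ∞ M]

/-- Tangent vectors at `x` are identified with `E` through the preferred chart at `x`, so the
derivative of that chart at its own centre is the identity. -/
lemma vectorFieldInChart_extChartAt_self (X : Π x : M, TangentSpace I x) (x : M) :
    vectorFieldInChart I X x (extChartAt I x x) = X x := by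
  have : IsManifold I 1 M := .of_le (n := ∞) (by simp)
  let f : M → E := X
  have h : (mfderivWithin 𝓘(ℝ, E) I (extChartAt I x).symm (range I) (extChartAt I x x) :
      E →L[ℝ] E) = ContinuousLinearMap.id ℝ E := mfderivWithin_range_extChartAt_symm
  show @Eq E _ _
  calc (show E from vectorFieldInChart I X x (extChartAt I x x))
    _ = (ContinuousLinearMap.id ℝ E).inverse (f ((extChartAt I x).symm (extChartAt I x x))) :=
        congrArg (fun A : E →L[ℝ] E => A.inverse (f _)) h
    _ = f ((extChartAt I x).symm (extChartAt I x x)) := by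
        rw [ContinuousLinearMap.inverse_id, ContinuousLinearMap.id_apply]
    _ = f x := congrArg f (extChartAt_to_inv x)

lemma oneFormInChart_extChartAt_self (α : Π x : M, CotangentSpace I x) (x : M) :
    oneFormInChart I α x (extChartAt I x x) = α x := by
  have : IsManifold I 1 M := .of_le (n := ∞) (by simp)
  simp only [oneFormInChart, mfderivWithin_range_extChartAt_symm]
  rw [extChartAt_to_inv]
  rfl

variable [I.Boundaryless]

lemma mlieBracket_eq_fderiv (V W : Π x : M, TangentSpace I x) (x : M) :
    mlieBracket I V W x =
      (fderiv ℝ (vectorFieldInChart I W x) (extChartAt I x x) (V x : E)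
        - fderiv ℝ (vectorFieldInChart I V x) (extChartAt I x x) (W x : E) : E) := by
  have : IsManifold I 1 M := .of_le (n := ∞) (by simp)
  rw [← vectorFieldInChart_extChartAt_self I V x, ← vectorFieldInChart_extChartAt_self I W x]
  have h : (mfderiv I 𝓘(ℝ, E) (extChartAt I x) x : E →L[ℝ] E) = ContinuousLinearMap.id ℝ E :=
    mfderiv_extChartAt_self
  show @Eq E _ _
  calc (show E from mlieBracket I V W x)
    _ = (ContinuousLinearMap.id ℝ E).inverse
          (lieBracketWithin ℝ (vectorFieldInChart I V x) (vectorFieldInChart I W x)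
            ((extChartAt I x).symm ⁻¹' univ ∩ range I) (extChartAt I x x)) :=
        congrArg (fun A : E →L[ℝ] E => A.inverse _) h
    _ = _ := by
        rw [ContinuousLinearMap.inverse_id, ContinuousLinearMap.id_apply, preimage_univ,
          univ_inter, I.range_eq_univ, lieBracketWithin_univ, lieBracket_eq]

lemma lieDerivOneForm_eq_fderiv (Z : Π x : M, TangentSpace I x) (α : Π x : M, CotangentSpace I x)
    (x : M) :
    lieDerivOneForm I Z α x =
      let a : E →L[ℝ] ℝ := α x
      fderiv ℝ (oneFormInChart I α x) (extChartAt I x x) (Z x : E)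
        + a.comp (fderiv ℝ (vectorFieldInChart I Z x) (extChartAt I x x)) := by
  have : IsManifold I 1 M := .of_le (n := ∞) (by simp)
  rw [← vectorFieldInChart_extChartAt_self I Z x, ← oneFormInChart_extChartAt_self I α x]
  simp only [lieDerivOneForm, mfderiv_extChartAt_self, I.range_eq_univ, fderivWithin_univ]
  rfl

variable {I}

lemma IsSmoothPairOn.differentiableAt_vectorFieldInChart {s : Π x : M, BigTangent I x} {U : Set M}
    (hs : IsSmoothPairOn I s U) (hU : IsOpen U) {x : M} (hx : x ∈ U) [CompleteSpace E] :
    DifferentiableAt ℝ (vectorFieldInChart I (fun y => (s y).1) x) (extChartAt I x x) := by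
  have h := contMDiffWithinAt_mpullbackWithin_extChartAt_symm (m := 1) (n := ∞)
    (V := fun y => (s y).1) ((hs.1 x hx).of_le (by simp)) hU.uniqueMDiffOn hx
    (WithTop.coe_le_coe.2 le_top)
  have h' : ContMDiffAt 𝓘(ℝ, E) 𝓘(ℝ, E).tangent 1 _ (extChartAt I x x) := h.contMDiffAt (by
    refine Filter.inter_mem (extChartAt_target_mem_nhds x) ?_
    exact (continuousAt_extChartAt_symm x).preimage_mem_nhds
      (by rw [extChartAt_to_inv]; exact hU.mem_nhds hx))
  rw [contMDiffAt_vectorSpace_iff_contDiffAt] at h'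
  exact h'.differentiableAt (by simp)

lemma IsSmoothPairOn.differentiableAt_oneFormInChart {s : Π x : M, BigTangent I x} {U : Set M}
    (hs : IsSmoothPairOn I s U) (hU : IsOpen U) {x : M} (hx : x ∈ U) :
    DifferentiableAt ℝ (oneFormInChart I (fun y => (s y).2) x) (extChartAt I x x) := by
  have : IsManifold I 1 M := .of_le (n := ∞) (by simp)
  have h := (hs.2.contMDiffAt (hU.mem_nhds hx))
  rw [contMDiffAt_hom_bundle] at h
  have h2 := h.2.comp_of_eq (x := extChartAt I x x)
    ((contMDiffOn_extChartAt_symm (n := ∞) x).contMDiffAt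
      (extChartAt_target_mem_nhds x)) (extChartAt_to_inv x)
  -- The hom-bundle coordinates of the form agree with `oneFormInChart` on the chart target, hence
  -- near the point.
  have h3 : DifferentiableAt ℝ _ (extChartAt I x x) := h2.contDiffAt.differentiableAt (by simp)
  refine h3.congr_of_eventuallyEq ?_
  filter_upwards [extChartAt_target_mem_nhds (I := I) x] with z hz
  have hz' : (extChartAt I x).symm z ∈ (chartAt H x).source := by
    simpa using (extChartAt I x).map_target hz
  simp only [oneFormInChart, Function.comp_apply, ContinuousLinearMap.inCoordinates]
  rw [TangentBundle.symmL_trivializationAt hz', (extChartAt I x).right_inv hz]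
  ext e
  simp

end Charts

/-! ### Lifts and the Euler field in induced coordinates -/

section TangentCharts

variable {E : Type*} [NormedAddCommGroup E] [NormedSpace ℝ E]
  {H : Type*} [TopologicalSpace H] (I : ModelWithCorners ℝ E H)
  {M : Type*} [TopologicalSpace M] [ChartedSpace H M] [IsManifold I ∞ M]

lemma extChartAt_tangent_mk (v : TangentBundle I M) (x : M) (u : TangentSpace I x) :
    extChartAt I.tangent v ⟨x, u⟩ =
      (extChartAt I v.proj x, tangentCoordChange I x v.proj x u) := by
  rfl

lemma extChartAt_tangent_mk_self (v : TangentBundle I M) (u : TangentSpace I v.proj) :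
    extChartAt I.tangent v ⟨v.proj, u⟩ = (extChartAt I v.proj v.proj, u) := by
  exact congrArg (Prod.mk _) (tangentCoordChange_self (mem_extChartAt_source _))

lemma mdifferentiableAt_totalSpaceMk (x : M) (u : E) :
    MDifferentiableAt 𝓘(ℝ, E) I.tangent (fun u : E => (⟨x, u⟩ : TangentBundle I M)) u := by
  rw [mdifferentiableAt_totalSpace]
  refine ⟨mdifferentiableAt_const, ?_⟩
  exact (tangentCoordChange I x x x).mdifferentiableAt

/-- On a single fibre the chart is a constant paired with a linear coordinate change, which is its
own derivative. -/
lemma mfderiv_extChartAt_verticalVector (v w : TangentBundle I M)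
    (h : w.proj ∈ (chartAt H v.proj).source) (u : TangentSpace I w.proj) :
    mfderiv I.tangent 𝓘(ℝ, E × E) (extChartAt I.tangent v) w (verticalVector I w u) =
      ((0, tangentCoordChange I w.proj v.proj w.proj u) : E × E) := by
  have h1 : MDifferentiableAt I.tangent 𝓘(ℝ, E × E) (extChartAt I.tangent v) w := by
    refine mdifferentiableAt_extChartAt ?_
    simpa using h
  let e : E := w.snd
  have h2 := mfderiv_comp (I'' := 𝓘(ℝ, E × E)) e h1
    (mdifferentiableAt_totalSpaceMk I w.proj w.snd)
  have h3 : HasFDerivAt (fun u : E => ((extChartAt I v.proj w.proj,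
      tangentCoordChange I w.proj v.proj w.proj u) : E × E))
      ((0 : E →L[ℝ] E).prod (tangentCoordChange I w.proj v.proj w.proj)) e :=
    (hasFDerivAt_const _ _).prodMk (tangentCoordChange I w.proj v.proj w.proj).hasFDerivAt
  have h4 := h3.hasMFDerivAt.mfderiv
  have h5 := h2.symm.trans h4
  exact DFunLike.congr_fun h5 u

lemma verticalVector_eq (v : TangentBundle I M) (u : TangentSpace I v.proj) :
    verticalVector I v u = ((0, u) : E × E) := by
  have h := mfderiv_extChartAt_verticalVector I v v (mem_chart_source _ _) u
  rw [mfderiv_extChartAt_self] at h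
  exact h.trans (congrArg (Prod.mk _) (tangentCoordChange_self (mem_extChartAt_source _)))

lemma mfderiv_tangentBundle_proj (v : TangentBundle I M) :
    mfderiv I.tangent I (fun u : TangentBundle I M => u.proj) v =
      ContinuousLinearMap.fst ℝ E E := by
  have : IsManifold I 1 M := .of_le (n := ∞) (by simp)
  have h0 : MDifferentiableAt I.tangent I (fun u : TangentBundle I M => u.proj) v :=
    (contMDiff_proj (n := 1) (TangentSpace I : M → Type _)).mdifferentiableAt (by simp)
  have h1 := mfderiv_comp (I'' := 𝓘(ℝ, E)) v
    (mdifferentiableAt_extChartAt (I := I) (mem_chart_source H v.proj)) h0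
  have h1' := mfderiv_comp (I'' := 𝓘(ℝ, E)) (g := (Prod.fst : E × E → E)) v
    differentiableAt_fst.mdifferentiableAt
    (mdifferentiableAt_extChartAt (I := I.tangent) (mem_chart_source (ModelProd H E) v))
  rw [mfderiv_extChartAt_self] at h1 h1'
  have h2 := h1.symm.trans h1'
  rw [mfderiv_eq_fderiv, fderiv_fst] at h2
  exact h2

/-- Needed on the whole chart target, not only at the centre, because the bracket differentiates
these coefficients. -/
lemma vectorFieldInChart_eulerField (v : TangentBundle I M) {z : E × E}
    (hz : z ∈ (extChartAt I.tangent v).target) :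
    vectorFieldInChart I.tangent (eulerField I) v z = ((0, z.2) : E × E) := by
  have : IsManifold I.tangent 1 (TangentBundle I M) := .of_le (n := ∞) (by simp)
  set w := (extChartAt I.tangent v).symm z with hw
  have hws := (extChartAt I.tangent v).map_target hz
  have hwz : extChartAt I.tangent v w = z := (extChartAt I.tangent v).right_inv hz
  have h : w.proj ∈ (chartAt H v.proj).source := by
    rw [extChartAt_source] at hws
    exact (TangentBundle.mem_chart_source_iff _ _).1 hws
  have key := mfderiv_extChartAt_verticalVector I v w h w.snd
  have h2 := extChartAt_tangent_mk I v w.proj w.snd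
  have h3 : tangentCoordChange I w.proj v.proj w.proj w.snd = z.2 := by
    rw [← hwz]; exact (congrArg Prod.snd h2).symm
  rw [h3] at key
  refine Eq.trans ?_ key
  exact ((isInvertible_mfderivWithin_extChartAt_symm hz).inverse_apply_eq).2
    (DFunLike.congr_fun (mfderivWithin_extChartAt_symm_comp_mfderiv_extChartAt hz)
      (eulerField I w)).symm

lemma completeLiftVector_eq (X : Π x : M, TangentSpace I x) (v : TangentBundle I M) :
    completeLiftVector I X v = ((X v.proj, fderivWithin ℝ (vectorFieldInChart I X v.proj) (range I)
      (extChartAt I v.proj v.proj) v.snd) : E × E) := by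
  have : IsManifold I.tangent 1 (TangentBundle I M) := .of_le (n := ∞) (by simp)
  have h : (mfderivWithin 𝓘(ℝ, E × E) I.tangent (extChartAt I.tangent v).symm (range I.tangent)
      (extChartAt I.tangent v v) : E × E →L[ℝ] E × E) = ContinuousLinearMap.id ℝ (E × E) :=
    mfderivWithin_range_extChartAt_symm
  refine (DFunLike.congr_fun h _).trans ?_
  have hp : extChartAt I.tangent v v = (extChartAt I v.proj v.proj, (v.snd : E)) :=
    extChartAt_tangent_mk_self I v v.snd
  rw [hp]
  exact congrArg (fun e : E => (e, (_ : E))) (vectorFieldInChart_extChartAt_self I X v.proj)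

lemma completeLiftForm_eq (α : Π x : M, CotangentSpace I x) (v : TangentBundle I M) :
    completeLiftForm I α v =
      let a : E →L[ℝ] ℝ := α v.proj
      (fderivWithin ℝ (oneFormInChart I α v.proj) (range I)
        (extChartAt I v.proj v.proj) v.snd).coprod a := by
  have : IsManifold I.tangent 1 (TangentBundle I M) := .of_le (n := ∞) (by simp)
  have h : (mfderiv I.tangent 𝓘(ℝ, E × E) (extChartAt I.tangent v) v : E × E →L[ℝ] E × E) =
      ContinuousLinearMap.id ℝ (E × E) := mfderiv_extChartAt_self
  refine (congrArg (ContinuousLinearMap.comp (M₃ := ℝ) _) h).trans ?_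
  have hp : extChartAt I.tangent v v = (extChartAt I v.proj v.proj, (v.snd : E)) :=
    extChartAt_tangent_mk_self I v v.snd
  rw [hp]
  exact congrArg (ContinuousLinearMap.coprod _) (oneFormInChart_extChartAt_self I α v.proj)

lemma verticalLiftForm_eq (α : Π x : M, CotangentSpace I x) (v : TangentBundle I M) :
    verticalLiftForm I α v =
      let a : E →L[ℝ] ℝ := α v.proj
      a.comp (ContinuousLinearMap.fst ℝ E E) := by
  let a : E →L[ℝ] ℝ := α v.proj
  exact congrArg a.comp (mfderiv_tangentBundle_proj I v)

/-! ### Fibre scaling and its derivative -/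

variable (E) in
/-- The endomorphism `(x, v) ↦ (x, t v)` of `E × E`. -/
def scaleSnd (t : ℝ) : E × E →L[ℝ] E × E :=
  (ContinuousLinearMap.inl ℝ E E).comp (ContinuousLinearMap.fst ℝ E E) +
    t • (ContinuousLinearMap.inr ℝ E E).comp (ContinuousLinearMap.snd ℝ E E)

/-- The pullback of a pair (vector, covector) on `E × E` under `(x, v) ↦ (x, t v)`, with the vector
multiplied by `t`. -/
def homogeneousPullback (t : ℝ) (a : (E × E) × (E × E →L[ℝ] ℝ)) : (E × E) × (E × E →L[ℝ] ℝ) :=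
  ((t • a.1.1, a.1.2), a.2.comp (scaleSnd E t))

lemma homogeneousPullback_complete (t : ℝ) (ξ y : E) (dξ : E →L[ℝ] E) (a : E →L[ℝ] ℝ)
    (da : E →L[ℝ] E →L[ℝ] ℝ) :
    homogeneousPullback t ((ξ, dξ (t • y)), (da (t • y)).coprod a) =
      t • ((ξ, dξ y), (da y).coprod a) := by
  refine Prod.ext (Prod.ext rfl (map_smul dξ t y)) ?_
  ext <;> simp [homogeneousPullback, scaleSnd]

lemma homogeneousPullback_vertical (t : ℝ) (ξ : E) (a : E →L[ℝ] ℝ) :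
    homogeneousPullback t ((0, ξ), a.comp (ContinuousLinearMap.fst ℝ E E)) =
      ((0, ξ), a.comp (ContinuousLinearMap.fst ℝ E E)) := by
  refine Prod.ext (Prod.ext (smul_zero t) rfl) ?_
  ext <;> simp [homogeneousPullback, scaleSnd]

/-- The operation is linear for fixed `t`, so generators suffice. Scaling the vector part by `t`
avoids inverting `t`, so `t = 0` is allowed. -/
lemma homogeneousPullback_mem_tangentDirac (D : Π x : M, Submodule ℝ (BigTangent I x))
    (v : TangentBundle I M) (t : ℝ) {a : (E × E) × (E × E →L[ℝ] ℝ)}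
    (ha : a ∈ tangentDirac I D ⟨v.proj, t • v.snd⟩) :
    homogeneousPullback t a ∈ tangentDirac I D v := by
  induction ha using Submodule.span_induction with
  | zero =>
    have h : homogeneousPullback t (0 : (E × E) × (E × E →L[ℝ] ℝ)) = 0 := by
      simp [homogeneousPullback]
    exact Eq.subst (motive := fun b => b ∈ tangentDirac I D v) h.symm
      (tangentDirac I D v).zero_mem
  | add a b _ _ ha hb =>
    have h (a b : (E × E) × (E × E →L[ℝ] ℝ)) : homogeneousPullback t (a + b) =
        homogeneousPullback t a + homogeneousPullback t b := by
      simp [homogeneousPullback]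
    exact (h a b) ▸ (tangentDirac I D v).add_mem ha hb
  | smul c a _ ha =>
    have h (c : ℝ) (a : (E × E) × (E × E →L[ℝ] ℝ)) : homogeneousPullback t (c • a) =
        c • homogeneousPullback t a := by
      simp [homogeneousPullback, smul_comm t c]
    exact (h c a) ▸ (tangentDirac I D v).smul_mem c ha
  | mem a ha =>
    obtain ⟨U, s, hs, hv, rfl | rfl⟩ := ha
    · have key := (tangentDirac I D v).smul_mem t
        (Submodule.subset_span ⟨U, s, hs, hv, Or.inl rfl⟩)
      rw [completeLiftVector_eq, completeLiftForm_eq] at key ⊢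
      exact Eq.subst (motive := fun b => b ∈ tangentDirac I D v)
        (homogeneousPullback_complete t _ _ _ _ _).symm key
    · have key : (verticalLiftVector I (fun x => (s x).1) v,
          verticalLiftForm I (fun x => (s x).2) v) ∈ tangentDirac I D v :=
        Submodule.subset_span ⟨U, s, hs, hv, Or.inr rfl⟩
      rw [verticalLiftVector, verticalVector_eq, verticalLiftForm_eq] at key ⊢
      exact Eq.subst (motive := fun b => b ∈ tangentDirac I D v)
        (homogeneousPullback_vertical t _ _).symm key

lemma hasDerivAt_scaleSnd (t : ℝ) : HasDerivAt (scaleSnd E)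
    ((ContinuousLinearMap.inr ℝ E E).comp (ContinuousLinearMap.snd ℝ E E)) t := by
  simpa only [one_smul] using! ((hasDerivAt_id t).smul_const
    ((ContinuousLinearMap.inr ℝ E E).comp (ContinuousLinearMap.snd ℝ E E))).const_add
    ((ContinuousLinearMap.inl ℝ E E).comp (ContinuousLinearMap.fst ℝ E E))

lemma hasDerivAt_homogeneousPullback {X : E × E → E × E} {α : E × E → (E × E →L[ℝ] ℝ)} {p : E × E}
    (hX : DifferentiableAt ℝ X p) (hα : DifferentiableAt ℝ α p) :
    HasDerivAt (fun t : ℝ => homogeneousPullback t (X (p.1, t • p.2), α (p.1, t • p.2)))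
      (fderiv ℝ X p (0, p.2) - ((0, (X p).2) : E × E) + X p,
        fderiv ℝ α p (0, p.2) + (α p).comp
          ((ContinuousLinearMap.inr ℝ E E).comp (ContinuousLinearMap.snd ℝ E E))) 1 := by
  have hp : HasDerivAt (fun t : ℝ => (p.1, t • p.2)) ((0, p.2) : E × E) 1 := by
    simpa using (hasDerivAt_const (1 : ℝ) p.1).prodMk ((hasDerivAt_id (1 : ℝ)).smul_const p.2)
  have hp1 : p = (p.1, (1 : ℝ) • p.2) := by simp
  have h1 : HasDerivAt (fun t : ℝ => X (p.1, t • p.2)) (fderiv ℝ X p (0, p.2)) 1 :=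
    HasFDerivAt.comp_hasDerivAt_of_eq 1 hX.hasFDerivAt hp hp1
  have h2 : HasDerivAt (fun t : ℝ => α (p.1, t • p.2)) (fderiv ℝ α p (0, p.2)) 1 :=
    HasFDerivAt.comp_hasDerivAt_of_eq 1 hα.hasFDerivAt hp hp1
  have h11 : HasDerivAt (fun t : ℝ => (X (p.1, t • p.2)).1) (fderiv ℝ X p (0, p.2)).1 1 :=
    (ContinuousLinearMap.fst ℝ E E).hasFDerivAt.comp_hasDerivAt 1 h1
  have h12 : HasDerivAt (fun t : ℝ => (X (p.1, t • p.2)).2) (fderiv ℝ X p (0, p.2)).2 1 :=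
    (ContinuousLinearMap.snd ℝ E E).hasFDerivAt.comp_hasDerivAt 1 h1
  have h1s : scaleSnd E 1 = ContinuousLinearMap.id ℝ (E × E) := by ext <;> simp [scaleSnd]
  convert! (((hasDerivAt_id (1 : ℝ)).smul h11).prodMk h12).prodMk
    (h2.clm_comp (hasDerivAt_scaleSnd 1)) using 1
  refine Prod.ext (Prod.ext ?_ ?_) ?_ <;> simp [h1s]

lemma HasDerivAt.mem_submodule {F : Type*} [NormedAddCommGroup F] [NormedSpace ℝ F]
    [FiniteDimensional ℝ F] {L : Submodule ℝ F} {f : ℝ → F} {f' : F} {t : ℝ}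
    (hf : HasDerivAt f f' t) (h : ∀ᶠ u in 𝓝 t, f u ∈ L) : f' ∈ L := by
  refine (Submodule.closed_of_finiteDimensional L).mem_of_tendsto hf.tendsto_slope ?_
  filter_upwards [h.filter_mono nhdsWithin_le_nhds] with u hu
  exact L.smul_mem _ (L.sub_mem hu h.self_of_nhds)

end TangentCharts

end

theorem proposition3p3
    {E : Type*} [NormedAddCommGroup E] [NormedSpace ℝ E] [FiniteDimensional ℝ E]
    {H : Type*} [TopologicalSpace H] (I : ModelWithCorners ℝ E H) [I.Boundaryless]
    {M : Type*} [TopologicalSpace M] [ChartedSpace H M] [IsManifold I ∞ M]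
    (D : Π x : M, Submodule ℝ (BigTangent I x)) (hD : IsDiracStructure I D) :
    IsHomogeneousDirac I.tangent (tangentDirac I D) (eulerField I) := by
  have : CompleteSpace E := FiniteDimensional.complete ℝ E
  intro U s hs v hv
  have hp : extChartAt I.tangent v v = (extChartAt I v.proj v.proj, (v.snd : E)) :=
    extChartAt_tangent_mk_self I v v.snd
  have hX := hs.2.1.differentiableAt_vectorFieldInChart hs.1 hv
  have hα := hs.2.1.differentiableAt_oneFormInChart hs.1 hv
  have hd := hasDerivAt_homogeneousPullback hX hα
  have hE : fderiv ℝ (vectorFieldInChart I.tangent (eulerField I) v) (extChartAt I.tangent v v) =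
      (ContinuousLinearMap.inr ℝ E E).comp (ContinuousLinearMap.snd ℝ E E) := by
    have h : vectorFieldInChart I.tangent (eulerField I) v =ᶠ[𝓝 (extChartAt I.tangent v v)]
        ((ContinuousLinearMap.inr ℝ E E).comp (ContinuousLinearMap.snd ℝ E E)) := by
      filter_upwards [extChartAt_target_mem_nhds (I := I.tangent) v] with z hz
      exact vectorFieldInChart_eulerField I v hz
    exact h.fderiv_eq.trans (ContinuousLinearMap.fderiv _)
  -- The Euler field is linear in coordinates; its derivative supplies the term `-(0, X₂)` and the
  -- composition with `α` in `hd`.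
  rw [mlieBracket_eq_fderiv, lieDerivOneForm_eq_fderiv, hE]
  let L : Submodule ℝ ((E × E) × (E × E →L[ℝ] ℝ)) := tangentDirac I D v
  have hmem := hd.mem_submodule (L := L) (by
    rw [hp]
    -- The section is controlled only on `U`, so `t` is kept near `1`.
    have hc : Filter.Tendsto (fun t : ℝ => (extChartAt I.tangent v).symm
        (extChartAt I v.proj v.proj, t • (v.snd : E))) (𝓝 1) (𝓝 v) := by
      have h1 : Filter.Tendsto (fun t : ℝ => (extChartAt I v.proj v.proj, t • (v.snd : E))) (𝓝 1)
          (𝓝 (extChartAt I.tangent v v)) := by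
        rw [hp]
        let e : E := v.snd
        have h2 : Filter.Tendsto (fun t : ℝ => t • e) (𝓝 1) (𝓝 e) := by
          have h3 : Filter.Tendsto (fun t : ℝ => t • e) (𝓝 1) (𝓝 ((1 : ℝ) • e)) :=
            Filter.tendsto_id.smul_const e
          rwa [one_smul] at h3
        exact tendsto_const_nhds.prodMk_nhds h2
      have h2 := (continuousAt_extChartAt_symm (I := I.tangent) v).tendsto
      rw [extChartAt_to_inv] at h2
      exact h2.comp h1
    filter_upwards [hc (hs.1.mem_nhds hv)] with t ht
    refine homogeneousPullback_mem_tangentDirac I D v t ?_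
    let w : TangentBundle I M := ⟨v.proj, t • v.snd⟩
    have hw : extChartAt I.tangent w w = (extChartAt I v.proj v.proj, t • (v.snd : E)) :=
      extChartAt_tangent_mk_self I w w.snd
    have hwU : w ∈ U := by
      have : (extChartAt I.tangent v).symm (extChartAt I v.proj v.proj, t • (v.snd : E)) = w :=
        (congrArg (extChartAt I.tangent v).symm hw).symm.trans (extChartAt_to_inv w)
      exact this ▸ ht
    -- The preferred chart of `TM` depends only on the base point, so the charts at `w` and `v`
    -- coincide and the coefficients are the actual values at `w`.
    have h1 := vectorFieldInChart_extChartAt_self I.tangent (fun y => (s y).1) w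
    have h2 := oneFormInChart_extChartAt_self I.tangent (fun y => (s y).2) w
    rw [hw] at h1 h2
    exact Eq.subst (motive := fun b => b ∈ tangentDirac I D w) (Prod.ext h1.symm h2.symm)
      (hs.2.2 w hwU))
  have hXv := vectorFieldInChart_extChartAt_self I.tangent (fun y => (s y).1) v
  have hαv := oneFormInChart_extChartAt_self I.tangent (fun y => (s y).2) v
  have hEv : eulerField I v = ((0, (extChartAt I.tangent v v).2) : E × E) := by
    rw [hp]
    exact verticalVector_eq I v v.snd
  rw [hXv, hαv, ← hEv] at hmem
  exact hmem
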